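/- Let $0\le a<b$ and $\bar\Omega=[a,b]$, and let $C^1(\bar\Omega)$ carry the norm $\|D\|_\infty+\|D'\|_\infty$. For $D\in C^1(\bar\Omega)$ put $\phi_D(t)=t-D(t)$. Let $K\subset C^1(\bar\Omega)$ be a compact set of delay functions such that for every $D\in K$ there are constants $\pi_0,\pi_2>0$ with $t-\phi_D(t)\ge\pi_0$ and $\phi_D'(t)\ge\pi_2$ for all $t\in\bar\Omega$. Then $\phi_D$ is injective, and the prediction horizon $$\Psi(D)(t)=\phi_D^{-1}(t)-t$$ is defined for every $t\in\phi_D(\bar\Omega)$. Let $s:\mathbb R\to\mathbb R$ be a $C^\infty$ activation function that is not a polynomial. A network is a finite composition of maps $x\mapsto s(Wx+\beta)$ ($s$ acting componentwise) followed by an affine map. A neural operator from $C(\bar\Omega;\mathbb R)$ to $C(\bar\Omega;\mathbb R)$ is a map $\hat\Psi=\mathcal Q\circ\mathcal L_L\circ\dots\circ\mathcal L_1\circ\mathcal R$ with $L\ge1$ and a channel dimension $d\ge1$, where $$(\mathcal R u)(x)=R(u(x),x),\qquad (\mathcal Q v)(x)=Q(v(x),x),$$ $$(\mathcal L_l v)(x)=s\Big(W_lv(x)+b_l+\int_{\bar\Omega}K_l(x,y)\,v(y)\,dy\Big),$$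 with networks $R:\mathbb R\times\bar\Omega\to\mathbb R^{d}$ and $Q:\mathbb R^{d}\times\bar\Omega\to\mathbb R$, weights $W_l\in\mathbb R^{d\times d}$, biases $b_l\in\mathbb R^{d}$ and continuous kernels $K_l:\bar\Omega\times\bar\Omega\to\mathbb R^{d\times d}$. Then for every $\varepsilon>0$ there is a neural operator $\hat\Psi$ of this form, with kernels whose entries are themselves computed by networks in $(x,y)$, such that $$|\Psi(D)(t)-\hat\Psi(D)(t)|\le\varepsilon\qquad\text{for all } D\in K \text{ and all } t\in\bar\Omega\cap\phi_D(\bar\Omega).$$ -/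

import Mathlib

open Set MeasureTheory
open scoped ContDiff Matrix

noncomputable section

namespace DelayOperator

/-! ### The space of continuously differentiable functions on a bounded interval -/

/-- `C¹([a, b])`: a continuous function on `[a, b]` together with its derivative, which is
continuous on `[a, b]` (one-sided at the end points).  Differentiability within `[a, b]` only
involves the values on `[a, b]`, so the extension by zero plays no role. -/
structure C1Fun (a b : ℝ) where
  /-- the function -/
  toFun : C(Icc a b, ℝ)
  /-- its derivative -/
  deriv : C(Icc a b, ℝ)
  hasDeriv : ∀ x : Icc a b,
    HasDerivWithinAt (Function.extend Subtype.val toFun 0) (deriv x) (Icc a b) x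

/-- The topology of the norm `‖D‖_∞ + ‖D'‖_∞`: uniform convergence of functions and derivatives. -/
instance (a b : ℝ) : TopologicalSpace (C1Fun a b) :=
  TopologicalSpace.induced (fun D => (D.toFun, D.deriv)) inferInstance

/-! ### Delays and the prediction horizon -/

variable {a b : ℝ}

/-- The delay time `φ(t) = t - D(t)`. -/
def delayTime (D : C1Fun a b) (t : Icc a b) : ℝ := (t : ℝ) - D.toFun t

/-- The derivative `φ'(t) = 1 - D'(t)`. -/
def delayTimeDeriv (D : C1Fun a b) (t : Icc a b) : ℝ := 1 - D.deriv t

/-- The delay is bounded below by a positive constant: `t - φ(t) ≥ π₀ > 0`.  (The supremum of the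
delay is finite since `D` is continuous on a compact interval.) -/
def DelayPositive (D : C1Fun a b) : Prop :=
  ∃ π₀ : ℝ, 0 < π₀ ∧ ∀ t : Icc a b, π₀ ≤ (t : ℝ) - delayTime D t

/-- The delay time increases at a rate bounded below: `φ'(t) ≥ π₂ > 0`.  (The supremum of `φ'` is
finite since `D'` is continuous on a compact interval.) -/
def DelayInvertible (D : C1Fun a b) : Prop :=
  ∃ π₂ : ℝ, 0 < π₂ ∧ ∀ t : Icc a b, π₂ ≤ delayTimeDeriv D t

/-- The prediction horizon `Ψ(D)(t) = φ⁻¹(t) - t`, defined at the times `t` in the range of `φ`: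
the chosen preimage of `t` is the only one when `φ` is strictly increasing. -/
def predictionHorizon (D : C1Fun a b) (t : range (delayTime D)) : ℝ :=
  ((t.2.choose : Icc a b) : ℝ) - t

/-! ### Neural networks between Euclidean spaces -/

/-- The parameters of a feedforward network from `ℝⁿ` to `ℝᵐ` (any depth, any widths). -/
inductive Network : ℕ → ℕ → Type
  /-- the affine output layer -/
  | output {n m : ℕ} (W : Matrix (Fin m) (Fin n) ℝ) (β : Fin m → ℝ) : Network n m
  /-- a layer `x ↦ s (W x + β)`, followed by the remaining network -/
  | hidden {n k m : ℕ} (W : Matrix (Fin k) (Fin n) ℝ) (β : Fin k → ℝ) (rest : Network k m) :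
      Network n m

/-- The function computed by a network whose activation function is `s`. -/
def Network.eval (s : C(ℝ, ℝ)) : {n m : ℕ} → Network n m → (Fin n → ℝ) → (Fin m → ℝ)
  | _, _, .output W β, x => W *ᵥ x + β
  | _, _, .hidden W β rest, x => rest.eval s (fun i => s ((W *ᵥ x + β) i))

theorem Network.continuous_eval (s : C(ℝ, ℝ)) {n m : ℕ} (N : Network n m) :
    Continuous (N.eval s) := by
  induction N with
  | output W β => simp only [Network.eval]; fun_prop
  | hidden W β rest ih => simp only [Network.eval]; exact ih.comp (by fun_prop)

/-! ### Neural operators on a bounded interval -/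

/-- The parameters of a hidden layer with `d` channels: weights, biases and a matrix kernel. -/
structure HiddenLayer (a b : ℝ) (d : ℕ) where
  /-- the weights `W` -/
  weight : Matrix (Fin d) (Fin d) ℝ
  /-- the biases -/
  bias : Fin d → ℝ
  /-- the kernel `K(x, y)` of the nonlocal operator -/
  kernel : C(Icc a b × Icc a b, Matrix (Fin d) (Fin d) ℝ)

/-- The nonlocal operator `(𝒦 v)(x) = ∫ K(x, y) v(y) dy`. -/
def HiddenLayer.nonlocal {d : ℕ} (ℓ : HiddenLayer a b d) (v : C(Icc a b, Fin d → ℝ))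
    (x : Icc a b) : Fin d → ℝ :=
  ∫ y : Icc a b, ℓ.kernel (x, y) *ᵥ v y ∂(Measure.comap Subtype.val volume)

theorem HiddenLayer.continuous_nonlocal {d : ℕ} (ℓ : HiddenLayer a b d)
    (v : C(Icc a b, Fin d → ℝ)) : Continuous (ℓ.nonlocal v) := by
  have h : Continuous (Function.uncurry fun x y : Icc a b => ℓ.kernel (x, y) *ᵥ v y) := by
    simp only [Function.uncurry_def]
    fun_prop
  have hfin : IsFiniteMeasure (Measure.comap (Subtype.val : Icc a b → ℝ) volume) := by
    refine ⟨?_⟩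
    rw [(MeasurableEmbedding.subtype_coe measurableSet_Icc).comap_apply, image_univ,
      Subtype.range_coe]
    exact measure_Icc_lt_top
  have := continuous_parametric_integral_of_continuous
    (μ := Measure.comap (Subtype.val : Icc a b → ℝ) volume) h isCompact_univ
  simp only [Measure.restrict_univ] at this
  exact this

/-- The hidden layer `(ℒ v)(x) = s (W v(x) + b + (𝒦 v)(x))`, with `s` acting componentwise. -/
def HiddenLayer.apply (s : C(ℝ, ℝ)) {d : ℕ} (ℓ : HiddenLayer a b d)
    (v : C(Icc a b, Fin d → ℝ)) : C(Icc a b, Fin d → ℝ) where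
  toFun x i := s ((ℓ.weight *ᵥ v x + ℓ.bias + ℓ.nonlocal v x) i)
  continuous_toFun := by
    have := ℓ.continuous_nonlocal v
    fun_prop

/-- The kernel depends on finitely many learnable parameters: each entry is computed by a network
in the variables `(x, y)`. -/
def HiddenLayer.HasNetworkKernel (s : C(ℝ, ℝ)) {d : ℕ} (ℓ : HiddenLayer a b d) : Prop :=
  ∀ i j : Fin d, ∃ N : Network 2 1, ∀ x y : Icc a b,
    ℓ.kernel (x, y) i j = N.eval s ![(x : ℝ), (y : ℝ)] 0

/-- The parameters of a neural operator from `C([a, b]; ℝᶜ)` to `C([a, b]; ℝᵉ)`: a lifting network,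
one or more hidden layers and a projection network.  The head of the list of hidden layers acts
first. -/
structure NeuralOperator (a b : ℝ) (c e : ℕ) where
  /-- the channel dimension -/
  channels : ℕ
  channels_pos : 0 < channels
  /-- the network `R : ℝᶜ × [a, b] → ℝᵈ` of the lifting layer -/
  lift : Network (c + 1) channels
  /-- the hidden layers -/
  layers : List (HiddenLayer a b channels)
  layers_ne_nil : layers ≠ []
  /-- the network `Q : ℝᵈ × [a, b] → ℝᵉ` of the projection layer -/
  proj : Network (channels + 1) e

/-- The layer `u ↦ (x ↦ N (u(x), x))` given by a network `N`. -/
def pointwiseLayer (s : C(ℝ, ℝ)) {n m : ℕ} (N : Network (n + 1) m)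
    (u : C(Icc a b, Fin n → ℝ)) : C(Icc a b, Fin m → ℝ) where
  toFun x := N.eval s (Fin.snoc (α := fun _ => ℝ) (u x) (x : ℝ))
  continuous_toFun := by
    refine (N.continuous_eval s).comp (continuous_pi fun i => ?_)
    refine Fin.lastCases ?_ (fun j => ?_) i
    · simp only [Fin.snoc_last]; fun_prop
    · simp only [Fin.snoc_castSucc]; fun_prop

/-- The operator `𝒬 ∘ ℒ_L ∘ ⋯ ∘ ℒ₁ ∘ ℛ`. -/
def NeuralOperator.apply (s : C(ℝ, ℝ)) {c e : ℕ} (N : NeuralOperator a b c e)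
    (u : C(Icc a b, Fin c → ℝ)) : C(Icc a b, Fin e → ℝ) :=
  pointwiseLayer s N.proj
    (N.layers.foldl (fun v ℓ => ℓ.apply s v) (pointwiseLayer s N.lift u))

/-- A scalar function regarded as a function with one channel. -/
def C1Fun.toChannel (D : C1Fun a b) : C(Icc a b, Fin 1 → ℝ) where
  toFun x _ := D.toFun x
  continuous_toFun := by fun_prop

end DelayOperator

end

open DelayOperator

/-!
The inverse of an increasing delay time `φ(y) = y - D(y)` is an integral of a function of `D`:
since `{y | φ(y) < t}` is an interval with left end point `a`,
`φ⁻¹(t) = a + ∫ 1[t - φ(y) > 0] dy`. The derivatives `φ'` are bounded below by a common positive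
constant on the compact set `K`, so the indicator of the positive half-line may be replaced by a
continuous ramp `h` at a small cost that is uniform in `D` and `t` (`abs_integral_ramp_sub_le`).

With `z = D(y) - y` the integrand is `h (t + z)`. Replacing `h` by a polynomial and expanding it
at `z` gives a sum of products of polynomials in `t` and in `z`, and each factor is approximated by
networks with one hidden layer (`exists_shallow_separation`). Monomials are such limits because
`zᵏ s⁽ᵏ⁾(θ)` is the `k`-th derivative at `w = 0` of the neuron `s (w z + θ)`, and some
`s⁽ᵏ⁾(θ)` is nonzero as `s` is not a polynomial (`IsShallowLimit.polynomial`).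

The resulting operator has the shape of one hidden layer: the lifting network computes the factors
in `z` at the point `y`, and the factors in `t` form the first row of the kernel, all other entries
being zero. The activation function of the hidden layer is neutralized by scaling the kernel by a
small constant and choosing a bias where `s' ≠ 0`, so that `s` is nearly affine on the relevant
range (`exists_scale_sub_le`); the projection is the affine map that undoes it
(`exists_neuralOperator_apply_eq`).
-/

namespace DelayOperator

/-! ### Smooth functions that are not polynomials -/

/-- Over the reals a polynomial has a polynomial antiderivative. -/
theorem exists_polynomial_derivative_eq (p : Polynomial ℝ) :
    ∃ q : Polynomial ℝ, Polynomial.derivative q = p := by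
  induction p using Polynomial.induction_on' with
  | add p q hp hq =>
    obtain ⟨p', rfl⟩ := hp
    obtain ⟨q', rfl⟩ := hq
    exact ⟨p' + q', by simp⟩
  | monomial n c =>
    refine ⟨Polynomial.monomial (n + 1) (c / (n + 1)), ?_⟩
    rw [Polynomial.derivative_monomial, Nat.add_sub_cancel]
    congr 1
    push_cast
    field_simp

theorem exists_polynomial_of_iteratedDeriv_eq_zero {f : ℝ → ℝ} (hf : ContDiff ℝ ∞ f) (k : ℕ)
    (hk : ∀ x, iteratedDeriv k f x = 0) : ∃ p : Polynomial ℝ, ∀ x, f x = p.eval x := by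
  induction k generalizing f with
  | zero => exact ⟨0, fun x => by simpa using hk x⟩
  | succ k ih =>
    rw [iteratedDeriv_succ'] at hk
    obtain ⟨p, hp⟩ := ih (ContDiff.iterate_deriv 1 hf) hk
    obtain ⟨q, rfl⟩ := exists_polynomial_derivative_eq p
    have hfd : Differentiable ℝ f := hf.differentiable (by simp)
    have hconst := is_const_of_deriv_eq_zero (f := fun x => f x - q.eval x)
      (hfd.sub q.differentiable) fun x => by
        rw [deriv_fun_sub (hfd x) q.differentiableAt, Polynomial.deriv]
        exact sub_eq_zero.2 (hp x)
    refine ⟨q + Polynomial.C (f 0 - q.eval 0), fun x => ?_⟩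
    have := hconst x 0
    simp only [Polynomial.eval_add, Polynomial.eval_C]
    linarith

/-! ### Networks with one hidden layer -/

/-- The functions of one real variable computed by networks with a single hidden layer: the linear
combinations of `z ↦ s (w z + θ)`. -/
def shallowSpan (s : ℝ → ℝ) : Submodule ℝ (ℝ → ℝ) :=
  Submodule.span ℝ (range fun p : ℝ × ℝ => fun z => s (p.1 * z + p.2))

theorem shallowSpan_continuous {s g : ℝ → ℝ} (hs : Continuous s) (hg : g ∈ shallowSpan s) :
    Continuous g := by
  induction hg using Submodule.span_induction with
  | mem g hg => obtain ⟨p, rfl⟩ := hg; fun_prop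
  | zero => exact continuous_const
  | add f g _ _ hf hg => exact hf.add hg
  | smul c f _ hf => exact hf.const_smul c

/-- Finitely many ridge functions `x ↦ g k (w ⬝ᵥ x)` in a common direction `w` are computed by a
single network; its hidden neurons are those that occur in any of the `g k`. -/
theorem exists_network_eval_eq (s : C(ℝ, ℝ)) {n d : ℕ} (g : Fin d → ℝ → ℝ)
    (hg : ∀ k, g k ∈ shallowSpan s) (w : Fin n → ℝ) :
    ∃ N : Network n d, ∀ x k, N.eval s x k = g k (w ⬝ᵥ x) := by
  classical
  have h : ∀ k, ∃ c : (ℝ × ℝ) →₀ ℝ,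
      (c.sum fun p r => r • fun z => s (p.1 * z + p.2)) = g k := fun k =>
    Finsupp.mem_span_range_iff_exists_finsupp.1 (hg k)
  choose c hc using h
  set T : Finset (ℝ × ℝ) := Finset.univ.biUnion fun k => (c k).support with hT
  let e := T.equivFin
  refine ⟨.hidden (Matrix.of fun r i => (e.symm r).1.1 * w i) (fun r => (e.symm r).1.2)
    (.output (Matrix.of fun k r => c k (e.symm r).1) 0), fun x k => ?_⟩
  have hsub : (c k).support ⊆ T := Finset.subset_biUnion_of_mem (fun k => (c k).support)
    (Finset.mem_univ k)
  rw [← hc k, Finsupp.sum_of_support_subset _ hsub _ (by simp), Finset.sum_apply]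
  simp only [Network.eval, Pi.add_apply, Pi.zero_apply, add_zero, Matrix.mulVec, dotProduct,
    Matrix.of_apply, Pi.smul_apply, smul_eq_mul]
  rw [← Finset.sum_coe_sort T, ← Equiv.sum_comp e.symm]
  refine Finset.sum_congr rfl fun r _ => ?_
  simp only [mul_assoc, Finset.mul_sum]

/-- `f` is a limit, uniformly on bounded sets, of networks with a single hidden layer. -/
def IsShallowLimit (s f : ℝ → ℝ) : Prop :=
  ∀ M η : ℝ, 0 < η → ∃ g ∈ shallowSpan s, ∀ z, |z| ≤ M → |g z - f z| ≤ η

namespace IsShallowLimit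

variable {s : ℝ → ℝ}

theorem of_mem {f : ℝ → ℝ} (hf : f ∈ shallowSpan s) : IsShallowLimit s f :=
  fun _ _ hη => ⟨f, hf, fun z _ => by simpa using hη.le⟩

theorem of_limit {f : ℝ → ℝ}
    (h : ∀ M η : ℝ, 0 < η → ∃ g, IsShallowLimit s g ∧ ∀ z, |z| ≤ M → |g z - f z| ≤ η) :
    IsShallowLimit s f := by
  intro M η hη
  obtain ⟨g, hg, hgf⟩ := h M (η / 2) (by positivity)
  obtain ⟨k, hk, hkg⟩ := hg M (η / 2) (by positivity)
  refine ⟨k, hk, fun z hz => ?_⟩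
  have := abs_sub_le (k z) (g z) (f z)
  linarith [hgf z hz, hkg z hz]

theorem add {f g : ℝ → ℝ} (hf : IsShallowLimit s f) (hg : IsShallowLimit s g) :
    IsShallowLimit s (f + g) := by
  intro M η hη
  obtain ⟨f', hf', hff⟩ := hf M (η / 2) (by positivity)
  obtain ⟨g', hg', hgg⟩ := hg M (η / 2) (by positivity)
  refine ⟨f' + g', Submodule.add_mem _ hf' hg', fun z hz => ?_⟩
  have := abs_add_le (f' z - f z) (g' z - g z)
  rw [Pi.add_apply, Pi.add_apply, add_sub_add_comm]
  linarith [hff z hz, hgg z hz]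

theorem const_smul {f : ℝ → ℝ} (hf : IsShallowLimit s f) (c : ℝ) : IsShallowLimit s (c • f) := by
  intro M η hη
  obtain ⟨f', hf', hff⟩ := hf M (η / (|c| + 1)) (by positivity)
  refine ⟨c • f', Submodule.smul_mem _ c hf', fun z hz => ?_⟩
  rw [Pi.smul_apply, Pi.smul_apply, ← smul_sub, smul_eq_mul, abs_mul]
  have h1 := hff z hz
  have h2 : (|c| + 1) * (η / (|c| + 1)) = η := by field_simp
  nlinarith [abs_nonneg c, abs_nonneg (f' z - f z)]

/-- Differentiation with respect to a parameter preserves shallow limits, since the difference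
quotients converge uniformly on bounded sets. -/
theorem hasDerivAt {F F' : ℝ → ℝ → ℝ} (hF : ∀ w, IsShallowLimit s (F w))
    (hd : ∀ w z, HasDerivAt (fun v => F v z) (F' w z) w)
    (hc : Continuous (Function.uncurry F')) (w : ℝ) : IsShallowLimit s (F' w) := by
  refine of_limit fun M η hη => ?_
  have huc : UniformContinuousOn (Function.uncurry F')
      (Icc (w - 1) (w + 1) ×ˢ Icc (-M) M) :=
    (isCompact_Icc.prod isCompact_Icc).uniformContinuousOn_of_continuous hc.continuousOn
  obtain ⟨δ, hδ, hδ'⟩ := Metric.uniformContinuousOn_iff.1 huc η hη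
  set h := min 1 (δ / 2) with hh
  have hh0 : 0 < h := lt_min one_pos (by positivity)
  have hh1 : h ≤ 1 := min_le_left _ _
  have hhδ : h < δ := (min_le_right _ _).trans_lt (by linarith)
  refine ⟨h⁻¹ • (F (w + h) + (-1 : ℝ) • F w),
    ((hF _).add ((hF _).const_smul _)).const_smul _, fun z hz => ?_⟩
  have hz' := abs_le.1 hz
  have key := Convex.norm_image_sub_le_of_norm_hasDerivWithin_le
    (f := fun v => F v z - v * F' w z) (f' := fun v => F' v z - 1 * F' w z)
    (s := Icc w (w + h)) (x := w) (y := w + h) (C := η)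
    (fun v _ => ((hd v z).sub ((hasDerivAt_id v).mul_const _)).hasDerivWithinAt)
    (fun v hv => by
      have := hδ' (v, z) ⟨⟨by linarith [hv.1], by linarith [hv.2]⟩, hz'.1, hz'.2⟩ (w, z)
        ⟨⟨by linarith, by linarith⟩, hz'.1, hz'.2⟩ (by
          rw [Prod.dist_eq, dist_self, max_eq_left dist_nonneg, Real.dist_eq,
            abs_of_nonneg (by linarith [hv.1])]
          linarith [hv.2])
      rw [Real.dist_eq] at this
      rw [one_mul]
      exact this.le)
    (convex_Icc _ _) ⟨le_rfl, by linarith⟩ ⟨by linarith, le_rfl⟩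
  rw [add_sub_cancel_left, Real.norm_eq_abs, Real.norm_eq_abs, abs_of_pos hh0] at key
  have e : (h⁻¹ • (F (w + h) + (-1 : ℝ) • F w)) z - F' w z
      = (F (w + h) z - (w + h) * F' w z - (F w z - w * F' w z)) / h := by
    simp only [Pi.smul_apply, Pi.add_apply, smul_eq_mul]
    field_simp
    ring
  rw [e, abs_div, abs_of_pos hh0, div_le_iff₀ hh0]
  exact key

/-- Differentiating the neuron `s (w z + θ)` `k` times in its weight `w` gives a shallow limit. -/
theorem pow_mul_iteratedDeriv (hs : ContDiff ℝ ∞ s) (k : ℕ) (θ w : ℝ) :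
    IsShallowLimit s fun z => z ^ k * iteratedDeriv k s (w * z + θ) := by
  induction k generalizing w with
  | zero => simpa using of_mem (Submodule.subset_span ⟨(w, θ), rfl⟩)
  | succ k ih =>
    have hc : Continuous (iteratedDeriv (k + 1) s) :=
      hs.continuous_iteratedDeriv _ (by exact_mod_cast le_top)
    refine hasDerivAt (F := fun w z => z ^ k * iteratedDeriv k s (w * z + θ))
      (F' := fun w z => z ^ (k + 1) * iteratedDeriv (k + 1) s (w * z + θ)) ih (fun w z => ?_)
      (by simp only [Function.uncurry_def]; fun_prop) w
    have h1 : HasDerivAt (iteratedDeriv k s) (iteratedDeriv (k + 1) s (w * z + θ)) (w * z + θ) := by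
      rw [iteratedDeriv_succ]
      exact (hs.differentiable_iteratedDeriv k (by exact_mod_cast WithTop.coe_lt_top _)
        _).hasDerivAt
    have h2 : HasDerivAt (fun v : ℝ => v * z + θ) z w := by
      simpa using ((hasDerivAt_id w).mul_const z).add_const θ
    have h3 := (h1.comp w h2).const_mul (z ^ k)
    exact h3.congr_deriv (by ring)

/-- Choosing the bias `θ` with `s⁽ᵏ⁾(θ) ≠ 0` makes the monomial `zᵏ` a derivative in the weight, at
weight zero, of the neuron `s (w z + θ)`. -/
theorem polynomial (hs : ContDiff ℝ ∞ s) (hpoly : ∀ p : Polynomial ℝ, ∃ x : ℝ, s x ≠ p.eval x)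
    (p : Polynomial ℝ) : IsShallowLimit s fun z => p.eval z := by
  induction p using Polynomial.induction_on' with
  | add p q hp hq =>
    simp only [Polynomial.eval_add]
    exact hp.add hq
  | monomial k c =>
    have : ∃ θ, iteratedDeriv k s θ ≠ 0 := by
      by_contra! h
      obtain ⟨p, hp⟩ := exists_polynomial_of_iteratedDeriv_eq_zero hs k h
      obtain ⟨x, hx⟩ := hpoly p
      exact hx (hp x)
    obtain ⟨θ, hθ⟩ := this
    convert (pow_mul_iteratedDeriv hs k θ 0).const_smul (c / iteratedDeriv k s θ) using 1
    funext z
    simp only [Polynomial.eval_monomial, Pi.smul_apply, smul_eq_mul, zero_mul, zero_add]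
    field_simp

end IsShallowLimit

/-- Products of shallow limits are approximated by products of networks with one hidden layer. -/
theorem IsShallowLimit.exists_mul_sub_le {s f q : ℝ → ℝ} (hf : IsShallowLimit s f)
    (hq : IsShallowLimit s q) (hfc : Continuous f) (hqc : Continuous q) (M : ℝ) {η : ℝ}
    (hη : 0 < η) : ∃ g ∈ shallowSpan s, ∃ v ∈ shallowSpan s, ∀ x z, |x| ≤ M → |z| ≤ M →
      |g x * v z - f x * q z| ≤ η := by
  obtain ⟨A, hA⟩ := (isCompact_Icc (a := -M) (b := M)).exists_bound_of_continuousOn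
    hfc.continuousOn
  obtain ⟨B, hB⟩ := (isCompact_Icc (a := -M) (b := M)).exists_bound_of_continuousOn
    hqc.continuousOn
  set τ := min 1 (η / (|A| + |B| + 1)) with hτ
  have hτ0 : 0 < τ := lt_min one_pos (by positivity)
  have hτ1 : τ ≤ 1 := min_le_left _ _
  have hτη : τ * (|A| + |B| + 1) ≤ η := by
    rw [← le_div_iff₀ (by positivity)]
    exact min_le_right _ _
  obtain ⟨g, hg, hgf⟩ := hf M τ hτ0
  obtain ⟨v, hv, hvq⟩ := hq M τ hτ0
  refine ⟨g, hg, v, hv, fun x z hx hz => ?_⟩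
  have h1 := hgf x hx
  have h2 := hvq z hz
  have h3 : |f x| ≤ |A| := (hA x (abs_le.1 hx)).trans (le_abs_self A)
  have h4 : |q z| ≤ |B| := (hB z (abs_le.1 hz)).trans (le_abs_self B)
  have h5 : |v z| ≤ |B| + 1 := by
    have := abs_sub_abs_le_abs_sub (v z) (q z)
    linarith
  calc |g x * v z - f x * q z| = |(g x - f x) * v z + f x * (v z - q z)| := by ring_nf
    _ ≤ |g x - f x| * |v z| + |f x| * |v z - q z| := by
      rw [← abs_mul, ← abs_mul]; exact abs_add_le _ _
    _ ≤ τ * (|B| + 1) + |A| * τ := by gcongr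
    _ ≤ η := by linarith

/-- A continuous function of `x + z` is approximated by sums of products of networks in `x` and in
`z`: Weierstrass gives a polynomial, whose Taylor expansion at `z` separates the variables. -/
theorem exists_shallow_separation {s : ℝ → ℝ} (hs : ContDiff ℝ ∞ s)
    (hpoly : ∀ p : Polynomial ℝ, ∃ x : ℝ, s x ≠ p.eval x) {h : ℝ → ℝ} (hh : Continuous h) (M : ℝ)
    {η : ℝ} (hη : 0 < η) :
    ∃ (n : ℕ) (g v : Fin (n + 1) → ℝ → ℝ), (∀ k, g k ∈ shallowSpan s) ∧
      (∀ k, v k ∈ shallowSpan s) ∧ ∀ x z, |x| ≤ M → |z| ≤ M →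
        |∑ k, g k x * v k z - h (x + z)| ≤ η := by
  obtain ⟨P, hP⟩ := exists_polynomial_near_of_continuousOn (-(M + M)) (M + M) h hh.continuousOn
    (η / 2) (by positivity)
  set n := P.natDegree with hn
  have hprod : ∀ k : Fin (n + 1), ∃ g ∈ shallowSpan s, ∃ v ∈ shallowSpan s, ∀ x z, |x| ≤ M →
      |z| ≤ M → |g x * v z - (Polynomial.X ^ (k : ℕ)).eval x * (Polynomial.hasseDeriv k P).eval z|
        ≤ η / 2 / (n + 1) := fun k =>
    (IsShallowLimit.polynomial hs hpoly _).exists_mul_sub_le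
      (IsShallowLimit.polynomial hs hpoly _) (Polynomial.continuous _) (Polynomial.continuous _) M
      (by positivity)
  choose g hg v hv hgv using hprod
  refine ⟨n, g, v, hg, hv, fun x z hx hz => ?_⟩
  have hsep : P.eval (x + z) = ∑ k : Fin (n + 1),
      (Polynomial.X ^ (k : ℕ)).eval x * (Polynomial.hasseDeriv k P).eval z := by
    rw [← Polynomial.taylor_eval, Polynomial.eval_eq_sum_range' (n := n + 1)
      (by rw [Polynomial.natDegree_taylor]; omega), Finset.sum_range]
    refine Finset.sum_congr rfl fun k _ => ?_
    rw [Polynomial.taylor_coeff, Polynomial.eval_pow, Polynomial.eval_X, mul_comm]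
  have h1 : |∑ k, g k x * v k z - P.eval (x + z)| ≤ η / 2 := by
    rw [hsep, ← Finset.sum_sub_distrib]
    refine (Finset.abs_sum_le_sum_abs _ _).trans
      ((Finset.sum_le_sum fun k _ => hgv k x z hx hz).trans (le_of_eq ?_))
    rw [Finset.sum_const, Finset.card_univ, Fintype.card_fin, nsmul_eq_mul]
    push_cast
    field_simp
  have h2 := (hP (x + z) (abs_le.1 ((abs_add_le x z).trans (add_le_add hx hz)))).le
  have := abs_sub_le (∑ k, g k x * v k z) (P.eval (x + z)) (h (x + z))
  linarith

/-- Where `s' ≠ 0`, a rescaling of `s` is uniformly close to the identity on bounded sets. -/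
theorem exists_scale_sub_le {s : ℝ → ℝ} {s' θ : ℝ} (hs : HasDerivAt s s' θ) (hs' : s' ≠ 0) (B : ℝ)
    {η : ℝ} (hη : 0 < η) :
    ∃ c : ℝ, 0 < c ∧ ∀ r, |r| ≤ B → |(s (θ + c * r) - s θ) / (c * s') - r| ≤ η := by
  have hs'0 : 0 < |s'| := abs_pos.2 hs'
  have hlo := (hasDerivAt_iff_isLittleO_nhds_zero.1 hs).def
    (c := η * |s'| / (|B| + 1)) (by positivity)
  obtain ⟨ρ, hρ, hρ'⟩ := Metric.eventually_nhds_iff.1 hlo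
  have hc : 0 < ρ / (|B| + 1) := by positivity
  refine ⟨ρ / (|B| + 1), hc, fun r hr => ?_⟩
  set c := ρ / (|B| + 1) with hcdef
  have hcB : c * (|B| + 1) = ρ := by rw [hcdef]; field_simp
  have hrB : |r| < |B| + 1 := by linarith [le_abs_self B]
  have hcr : |c * r| < ρ := by
    rw [abs_mul, abs_of_pos hc, ← hcB]
    gcongr
  have h := hρ' (y := c * r) (by simpa [Real.dist_eq] using hcr)
  rw [smul_eq_mul, Real.norm_eq_abs, Real.norm_eq_abs] at h
  have e : (s (θ + c * r) - s θ) / (c * s') - r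
      = (s (θ + c * r) - s θ - c * r * s') / (c * s') := by
    field_simp
  rw [e, abs_div, abs_mul c s', abs_of_pos hc, div_le_iff₀ (by positivity)]
  refine h.trans ?_
  rw [abs_mul, abs_of_pos hc, div_mul_eq_mul_div, div_le_iff₀ (by positivity)]
  calc η * |s'| * (c * |r|) ≤ η * |s'| * (c * (|B| + 1)) := by gcongr
    _ = η * (c * |s'|) * (|B| + 1) := by ring

end DelayOperator

namespace DelayOperator

variable {a b : ℝ}

/-! ### Uniform bounds on a compact set of delays -/

theorem C1Fun.continuous_toFun_deriv :
    Continuous fun D : C1Fun a b => (D.toFun, D.deriv) :=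
  continuous_induced_dom

theorem exists_uniform_delayTimeDeriv_bound {K : Set (C1Fun a b)} (hK : IsCompact K)
    (hinv : ∀ D ∈ K, DelayInvertible D) :
    ∃ c : ℝ, 0 < c ∧ ∀ D ∈ K, ∀ t, c ≤ delayTimeDeriv D t := by
  have hc : Continuous fun p : C1Fun a b × Icc a b => delayTimeDeriv p.1 p.2 := by
    have := (C1Fun.continuous_toFun_deriv (a := a) (b := b)).snd
    unfold delayTimeDeriv
    fun_prop
  obtain ⟨c, hc0, h⟩ := (hK.prod (isCompact_univ (X := Icc a b))).exists_forall_le'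
    hc.continuousOn (a := 0) fun p hp => by
      obtain ⟨c, hc0, h⟩ := hinv p.1 hp.1
      exact hc0.trans_le (h p.2)
  exact ⟨c, hc0, fun D hD t => h (D, t) ⟨hD, mem_univ t⟩⟩

theorem exists_uniform_delay_bound {K : Set (C1Fun a b)} (hK : IsCompact K) :
    ∃ B : ℝ, ∀ D ∈ K, ∀ t, |D.toFun t| ≤ B := by
  have hc : Continuous fun p : C1Fun a b × Icc a b => p.1.toFun p.2 := by
    have := (C1Fun.continuous_toFun_deriv (a := a) (b := b)).fst
    fun_prop
  obtain ⟨B, h⟩ := (hK.prod (isCompact_univ (X := Icc a b))).exists_bound_of_continuousOn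
    hc.continuousOn
  exact ⟨B, fun D hD t => h (D, t) ⟨hD, mem_univ t⟩⟩

theorem mul_sub_le_delayTime_sub {D : C1Fun a b} {c : ℝ} (hD : ∀ t, c ≤ delayTimeDeriv D t)
    {y z : Icc a b} (hyz : y ≤ z) : c * ((z : ℝ) - y) ≤ delayTime D z - delayTime D y := by
  set f : ℝ → ℝ := fun x => x - Function.extend Subtype.val D.toFun 0 x with hf
  have hd : ∀ x : Icc a b, HasDerivWithinAt f (delayTimeDeriv D x) (Icc a b) x := fun x =>
    (hasDerivWithinAt_id _ _).sub (D.hasDeriv x)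
  have hd' : ∀ x (hx : x ∈ interior (Icc a b)),
      HasDerivAt f (delayTimeDeriv D ⟨x, interior_subset hx⟩) x := fun x hx =>
    (hd ⟨x, interior_subset hx⟩).hasDerivAt (mem_interior_iff_mem_nhds.1 hx)
  have hfv : ∀ x : Icc a b, f x = delayTime D x := fun x => by
    simp only [hf, delayTime, Subtype.val_injective.extend_apply]
  rw [← hfv, ← hfv]
  exact (convex_Icc a b).mul_sub_le_image_sub_of_le_deriv
    (fun x hx => (hd ⟨x, hx⟩).continuousWithinAt)
    (fun x hx => (hd' x hx).differentiableAt.differentiableWithinAt)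
    (fun x hx => by rw [(hd' x hx).deriv]; exact hD _) y y.2 z z.2 hyz

theorem delayTime_strictMono {D : C1Fun a b} (hD : DelayInvertible D) :
    StrictMono (delayTime D) := fun y z hyz => by
  obtain ⟨c, hc, h⟩ := hD
  have := mul_sub_le_delayTime_sub h hyz.le
  have := mul_pos hc (sub_pos.2 (Subtype.coe_lt_coe.2 hyz))
  linarith

theorem predictionHorizon_delayTime {D : C1Fun a b} (hD : DelayInvertible D) (τ : Icc a b) :
    predictionHorizon D ⟨delayTime D τ, mem_range_self τ⟩ = τ - delayTime D τ := by
  have h : (mem_range_self (f := delayTime D) τ).choose = τ :=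
    (delayTime_strictMono hD).injective (mem_range_self (f := delayTime D) τ).choose_spec
  simp only [predictionHorizon, h]

/-! ### The inverse of the delay time as an integral -/

/-- Lebesgue measure on `[a, b]`. -/
noncomputable abbrev intervalMeasure (a b : ℝ) : Measure (Icc a b) := Measure.comap Subtype.val volume

instance : IsFiniteMeasure (intervalMeasure a b) := by
  refine ⟨?_⟩
  rw [(MeasurableEmbedding.subtype_coe measurableSet_Icc).comap_apply, image_univ,
    Subtype.range_coe]
  exact measure_Icc_lt_top

theorem intervalMeasure_real_Iic {c : ℝ} (hc : c ≤ b) :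
    (intervalMeasure a b).real {y | (y : ℝ) ≤ c} = max (c - a) 0 := by
  rw [measureReal_def, (MeasurableEmbedding.subtype_coe measurableSet_Icc).comap_apply]
  have : (Subtype.val '' {y : Icc a b | (y : ℝ) ≤ c}) = Icc a c := by
    ext x
    simp only [mem_image, mem_ofPred_eq, Subtype.exists, mem_Icc, exists_and_left,
      exists_prop, exists_eq_right_right]
    constructor
    · rintro ⟨h1, h2, h3⟩
      exact ⟨h2, h1⟩
    · rintro ⟨h1, h2⟩
      exact ⟨h2, h1, h2.trans hc⟩
  rw [this, Real.volume_Icc, ENNReal.toReal_ofReal']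

theorem intervalMeasure_real_univ (hab : a ≤ b) : (intervalMeasure a b).real univ = b - a := by
  have h : (univ : Set (Icc a b)) = {y : Icc a b | (y : ℝ) ≤ b} := by
    ext y
    simpa using y.2.2
  rw [h, intervalMeasure_real_Iic le_rfl, max_eq_left (by linarith)]

theorem integrable_of_continuous_interval {f : Icc a b → ℝ} (hf : Continuous f) :
    Integrable f (intervalMeasure a b) :=
  hf.integrable_of_hasCompactSupport (HasCompactSupport.of_compactSpace f)

/-- The continuous approximation of the indicator of the positive half-line that increases linearly
from `0` to `1` on `[0, δ]`. -/
noncomputable def ramp (δ w : ℝ) : ℝ := max 0 (min 1 (w / δ))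

theorem ramp_continuous (δ : ℝ) : Continuous (ramp δ) := by
  unfold ramp
  fun_prop

theorem ramp_nonneg (δ w : ℝ) : 0 ≤ ramp δ w := le_max_left _ _

theorem ramp_le_one (δ w : ℝ) : ramp δ w ≤ 1 := max_le zero_le_one (min_le_left _ _)

theorem ramp_eq_zero {δ w : ℝ} (hδ : 0 < δ) (hw : w ≤ 0) : ramp δ w = 0 :=
  max_eq_left ((min_le_right _ _).trans (div_nonpos_of_nonpos_of_nonneg hw hδ.le))

theorem ramp_eq_one {δ w : ℝ} (hδ : 0 < δ) (hw : δ ≤ w) : ramp δ w = 1 := by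
  rw [ramp, min_eq_left ((one_le_div hδ).2 hw), max_eq_right zero_le_one]

theorem delayTime_continuous (D : C1Fun a b) : Continuous (delayTime D) := by
  unfold delayTime
  fun_prop

/-- As `φ` is increasing, `φ⁻¹(t) - a` is the measure of `{y | φ(y) < t}`.  Replacing the indicator
of the positive half-line by a ramp of width `c * σ`, where `c ≤ φ'`, costs at most `σ`. -/
theorem abs_integral_ramp_sub_le {D : C1Fun a b} {c : ℝ} (hc : 0 < c)
    (hD : ∀ t, c ≤ delayTimeDeriv D t) (τ : Icc a b) {σ : ℝ} (hσ : 0 < σ) :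
    |∫ y, ramp (c * σ) (delayTime D τ - delayTime D y) ∂(intervalMeasure a b) - (τ - a)| ≤ σ := by
  have hcσ : 0 < c * σ := mul_pos hc hσ
  have hmeas : ∀ r : ℝ, MeasurableSet {y : Icc a b | (y : ℝ) ≤ r} := fun r =>
    measurableSet_le measurable_subtype_coe measurable_const
  have hφ := delayTime_continuous D
  have hr := ramp_continuous (c * σ)
  have hint : Integrable (fun y => ramp (c * σ) (delayTime D τ - delayTime D y))
      (intervalMeasure a b) := integrable_of_continuous_interval (by fun_prop)
  have hind : ∀ r : ℝ, Integrable (indicator {y : Icc a b | (y : ℝ) ≤ r} (1 : Icc a b → ℝ))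
      (intervalMeasure a b) := fun r => (integrable_const 1).indicator (hmeas r)
  have hlow : (intervalMeasure a b).real {y | (y : ℝ) ≤ τ - σ}
      ≤ ∫ y, ramp (c * σ) (delayTime D τ - delayTime D y) ∂(intervalMeasure a b) := by
    rw [← integral_indicator_one (hmeas _)]
    refine integral_mono (hind _) hint fun y => indicator_apply_le' (fun hy => ?_)
      fun _ => ramp_nonneg _ _
    rw [mem_ofPred_eq] at hy
    have h1 := mul_sub_le_delayTime_sub hD
      (show y ≤ τ from Subtype.coe_le_coe.1 (by linarith))
    have h2 : c * σ ≤ c * ((τ : ℝ) - y) := by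
      gcongr
      linarith
    rw [ramp_eq_one hcσ (h2.trans h1), Pi.one_apply]
  have hupp : ∫ y, ramp (c * σ) (delayTime D τ - delayTime D y) ∂(intervalMeasure a b)
      ≤ (intervalMeasure a b).real {y | (y : ℝ) ≤ τ} := by
    rw [← integral_indicator_one (hmeas _)]
    refine integral_mono hint (hind _) fun y => le_indicator_apply (fun _ => ramp_le_one _ _)
      fun hy => ?_
    rw [mem_ofPred_eq, not_le] at hy
    have h1 := mul_sub_le_delayTime_sub hD (Subtype.coe_lt_coe.1 hy).le
    have h2 := mul_pos hc (sub_pos.2 hy)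
    exact (ramp_eq_zero hcσ (by linarith)).le
  rw [intervalMeasure_real_Iic (by linarith [τ.2.2])] at hlow
  rw [intervalMeasure_real_Iic τ.2.2, max_eq_left (by linarith [τ.2.1])] at hupp
  have := le_max_left ((τ : ℝ) - σ - a) 0
  rw [abs_le]
  constructor <;> linarith

/-! ### Neural operators with one hidden layer -/

/-- A hidden layer without weights whose kernel, zero outside its first row, sends `v` to the function
`∫ ∑ₖ g k x * v k y dy` in the channel `0`, with the same bias in every channel. -/
def rowLayer {n : ℕ} (g : Fin (n + 1) → C(ℝ, ℝ)) (θ : ℝ) : HiddenLayer a b (n + 1) where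
  weight := 0
  bias _ := θ
  kernel :=
    { toFun := fun p => Matrix.of fun i k => if i = 0 then g k p.1 else 0
      continuous_toFun := by
        refine continuous_matrix fun i k => ?_
        by_cases hi : i = 0
        · simp only [Matrix.of_apply, hi, if_true]
          fun_prop
        · simp only [Matrix.of_apply, hi, if_false]
          fun_prop }

theorem rowLayer_hasNetworkKernel (s : C(ℝ, ℝ)) {n : ℕ} (g : Fin (n + 1) → C(ℝ, ℝ)) (θ : ℝ)
    (hg : ∀ k, ⇑(g k) ∈ shallowSpan s) :
    (rowLayer g θ : HiddenLayer a b (n + 1)).HasNetworkKernel s := by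
  intro i k
  by_cases hi : i = 0
  · obtain ⟨N, hN⟩ := exists_network_eval_eq s (fun _ : Fin 1 => g k) (fun _ => hg k)
      (![1, 0] : Fin 2 → ℝ)
    exact ⟨N, fun x y => by simp [hN, rowLayer, hi, dotProduct, Fin.sum_univ_two]⟩
  · exact ⟨.output 0 0, fun x y => by simp [Network.eval, rowLayer, hi]⟩

theorem rowLayer_apply_zero (s : C(ℝ, ℝ)) {n : ℕ} (g : Fin (n + 1) → C(ℝ, ℝ)) (θ : ℝ)
    (v : C(Icc a b, Fin (n + 1) → ℝ)) (x : Icc a b) :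
    (rowLayer g θ).apply s v x 0
      = s (θ + ∫ y, ∑ k, g k x * v y k ∂(intervalMeasure a b)) := by
  have hcont : Continuous fun y => (rowLayer (a := a) (b := b) g θ).kernel (x, y) *ᵥ v y := by
    fun_prop
  have h : (rowLayer g θ).nonlocal v x 0
      = ∫ y, ∑ k, g k x * v y k ∂(intervalMeasure a b) := by
    have hint : ∀ i, Integrable (fun y => ((rowLayer g θ).kernel (x, y) *ᵥ v y) i)
        (intervalMeasure a b) := fun i =>
      integrable_of_continuous_interval ((continuous_apply i).comp hcont)
    rw [HiddenLayer.nonlocal, eval_integral hint]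
    simp [rowLayer, Matrix.mulVec, dotProduct]
  change s (((rowLayer g θ).weight *ᵥ v x + (rowLayer g θ).bias
    + (rowLayer g θ).nonlocal v x) 0) = _
  rw [Pi.add_apply, Pi.add_apply, h]
  simp [rowLayer]

/-- An operator `u ↦ (A * s (θ + ∫ ∑ₖ g k x * v k (u y - y) dy) - x + B)` is a neural operator with a
single hidden layer. -/
theorem exists_neuralOperator_apply_eq (s : C(ℝ, ℝ)) {n : ℕ} (g v : Fin (n + 1) → ℝ → ℝ)
    (hg : ∀ k, g k ∈ shallowSpan s) (hv : ∀ k, v k ∈ shallowSpan s) (θ A B : ℝ) :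
    ∃ N : NeuralOperator a b 1 1, (∀ ℓ ∈ N.layers, ℓ.HasNetworkKernel s) ∧
      ∀ (D : C1Fun a b) (x : Icc a b), N.apply s D.toChannel x 0
        = A * s (θ + ∫ y, ∑ k, g k x * v k (D.toFun y - y) ∂(intervalMeasure a b)) - x + B := by
  obtain ⟨R, hR⟩ := exists_network_eval_eq s v hv (![1, -1] : Fin 2 → ℝ)
  let G : Fin (n + 1) → C(ℝ, ℝ) := fun k => ⟨g k, shallowSpan_continuous s.continuous (hg k)⟩
  refine ⟨⟨n + 1, n.succ_pos, R, [rowLayer G θ], by simp,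
    .output (Matrix.of fun _ => Fin.snoc (α := fun _ => ℝ) (Pi.single 0 A) (-1)) fun _ => B⟩,
    ?_, fun D x => ?_⟩
  · intro ℓ hℓ
    rw [List.mem_singleton.1 hℓ]
    exact rowLayer_hasNetworkKernel s G θ hg
  · have hlift : ∀ y k, pointwiseLayer s R D.toChannel y k = v k (D.toFun y - y) := fun y k => by
      change R.eval s (Fin.snoc (α := fun _ => ℝ) (D.toChannel y) (y : ℝ)) k = _
      rw [hR]
      congr 1
      rw [dotProduct, Fin.sum_univ_castSucc, Fin.sum_univ_one, Fin.snoc_last, Fin.snoc_castSucc]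
      simp [C1Fun.toChannel, sub_eq_add_neg]
    have happly := rowLayer_apply_zero s G θ (pointwiseLayer s R D.toChannel) x
    simp only [hlift] at happly
    change (Network.output _ _).eval s (Fin.snoc (α := fun _ => ℝ)
      ((rowLayer G θ).apply s (pointwiseLayer s R D.toChannel) x) (x : ℝ)) 0 = _
    rw [Network.eval, Pi.add_apply, Matrix.mulVec, dotProduct, Fin.sum_univ_castSucc]
    simp only [Matrix.of_apply, Fin.snoc_castSucc, Fin.snoc_last]
    rw [Finset.sum_eq_single 0 (fun k _ hk => by simp [hk]) (by simp), Pi.single_eq_same, happly]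
    simp only [G, ContinuousMap.coe_mk]
    ring

end DelayOperator

/-! ### Approximation of the prediction horizon -/

theorem theorem2 (a b : ℝ) (ha : 0 ≤ a) (hab : a < b)
    (s : C(ℝ, ℝ)) (hs : ContDiff ℝ ∞ s)
    (hpoly : ∀ p : Polynomial ℝ, ∃ x : ℝ, s x ≠ p.eval x)
    (K : Set (C1Fun a b)) (hK : IsCompact K)
    (hpos : ∀ D ∈ K, DelayPositive D) (hinv : ∀ D ∈ K, DelayInvertible D)
    (ε : ℝ) (hε : 0 < ε) :
    ∃ N : NeuralOperator a b 1 1,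
      (∀ ℓ ∈ N.layers, ℓ.HasNetworkKernel s) ∧
      ∀ D ∈ K, ∀ (t : Icc a b) (ht : (t : ℝ) ∈ range (delayTime D)),
        |predictionHorizon D ⟨t, ht⟩ - N.apply s D.toChannel t 0| ≤ ε := by
  obtain ⟨c, hc, hKc⟩ := exists_uniform_delayTimeDeriv_bound hK hinv
  obtain ⟨B, hB⟩ := exists_uniform_delay_bound hK
  have hba : 0 < b - a := sub_pos.2 hab
  -- `x` ranges over `[a, b]` and `D y - y` is bounded by `|B| + |a| + |b|`
  set M := |B| + |a| + |b| with hM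
  have habs : ∀ x : Icc a b, |(x : ℝ)| ≤ |a| + |b| := fun x => by
    rw [abs_le]
    constructor <;>
      linarith [x.2.1, x.2.2, neg_abs_le a, neg_abs_le b, le_abs_self a, le_abs_self b,
        abs_nonneg a, abs_nonneg b]
  -- a ramp of width `δ` costs `ε / 3`, as does the separation of variables after integration
  set δ := c * (ε / 3) with hδ
  obtain ⟨n, g, v, hg, hv, hgv⟩ := exists_shallow_separation hs hpoly (ramp_continuous δ) M
    (η := ε / 3 / (b - a)) (by positivity)
  obtain ⟨θ, hθ⟩ : ∃ θ, deriv s θ ≠ 0 := by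
    by_contra! h
    obtain ⟨p, hp⟩ := exists_polynomial_of_iteratedDeriv_eq_zero hs 1 (by simpa using h)
    obtain ⟨x, hx⟩ := hpoly p
    exact hx (hp x)
  -- the integral `J` below is within `2 * (ε / 3)` of `τ - a`, a number in `[0, b - a]`
  obtain ⟨r, hr, hrs⟩ := exists_scale_sub_le
    (hs.differentiable (by simp) θ).hasDerivAt hθ (ε / 3 + (b - a) + ε / 3) (η := ε / 3)
    (by positivity)
  obtain ⟨N, hN, hNeq⟩ := exists_neuralOperator_apply_eq (a := a) (b := b) s
    (fun k => r • g k) v (fun k => Submodule.smul_mem _ r (hg k)) hv θ (1 / (r * deriv s θ))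
    (a - s θ / (r * deriv s θ))
  refine ⟨N, hN, fun D hD t ht => ?_⟩
  obtain ⟨τ, hτ⟩ := ht
  have hΨ : predictionHorizon D ⟨t, ⟨τ, hτ⟩⟩ = τ - t := by
    have h := predictionHorizon_delayTime (hinv D hD) τ
    simp only [hτ] at h
    exact h
  set J := ∫ y, ∑ k, g k t * v k (D.toFun y - y) ∂(intervalMeasure a b) with hJ
  set H := ∫ y, ramp δ (delayTime D τ - delayTime D y) ∂(intervalMeasure a b) with hH
  have hHτ : |H - (τ - a)| ≤ ε / 3 := abs_integral_ramp_sub_le hc (hKc D hD) τ (by positivity)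
  have hJH : |J - H| ≤ ε / 3 := by
    have hφ := delayTime_continuous D
    have hrc := ramp_continuous δ
    have hvc := fun k => shallowSpan_continuous s.continuous (hv k)
    rw [hJ, hH, ← integral_sub (integrable_of_continuous_interval (by fun_prop))
      (integrable_of_continuous_interval (by fun_prop))]
    have hbound := norm_integral_le_of_norm_le_const (μ := intervalMeasure a b)
      (f := fun y : Icc a b => ∑ k, g k t * v k (D.toFun y - y)
        - ramp δ (delayTime D τ - delayTime D y)) (C := ε / 3 / (b - a))
      (Filter.Eventually.of_forall fun y => by
        have h := hgv t (D.toFun y - y) (by linarith [habs t, abs_nonneg B])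
          ((abs_sub _ _).trans (by linarith [habs y, hB D hD y, le_abs_self B]))
        rwa [show (t : ℝ) + (D.toFun y - y) = delayTime D τ - delayTime D y by
          rw [hτ, delayTime]; ring] at h)
    rw [intervalMeasure_real_univ hab.le, div_mul_cancel₀ _ hba.ne'] at hbound
    exact hbound
  have hJB : |J| ≤ ε / 3 + (b - a) + ε / 3 := by
    have h1 := abs_le.1 hJH
    have h2 := abs_le.1 hHτ
    rw [abs_le]
    constructor <;> linarith [τ.2.1, τ.2.2]
  have hint : ∫ y, ∑ k, (r • g k) t * v k (D.toFun y - y) ∂(intervalMeasure a b) = r * J := by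
    rw [hJ, ← integral_const_mul]
    simp only [Pi.smul_apply, smul_eq_mul, Finset.mul_sum, mul_assoc]
  have hout : N.apply s D.toChannel t 0 = (s (θ + r * J) - s θ) / (r * deriv s θ) - t + a := by
    rw [hNeq, hint]
    ring
  have h1 := abs_le.1 (hrs J hJB)
  have h2 := abs_le.1 hJH
  have h3 := abs_le.1 hHτ
  rw [hΨ, hout, abs_le]
  constructor <;> linarith
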